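/- Let $0<d<\infty$ and let $X=\{X_k\}_{k\ge 1}$ be an admissible sequence: $X_k\in B((\mathbb C^d)^{\otimes k})$, $X_k\ge 0$, $X_1$ is invertible and $\limsup_k\|X_k\|^{1/k}<\infty$. Write $X_k=(x_{\alpha,\beta})$, where $\alpha,\beta$ run over the words of length $k$ in $\{1,\dots,d\}$. For a $d$-tuple $T=(T_1,\dots,T_d)$ of bounded operators on a complex Hilbert space $G$ put $T_\alpha=T_{\alpha(1)}\cdots T_{\alpha(k)}$ and $$\Phi_T(a)=\sum_{k\ge1}T^{(k)}(X_k\otimes a)T^{(k)*}=\sum_{k\ge 1}\ \sum_{|\alpha|=|\beta|=k}x_{\alpha,\beta}\,T_\alpha aT_\beta^*\qquad(a\in B(G)),$$ a $w^*$-convergent sum, whenever the series for $a=I$ is $w^*$-convergent. Let $D(X,G)$ (resp. $\overline D(X,G)$) be the set of tuples for which $\Phi_T(I)$ converges and $\|\Phi_T(I)\|<1$ (resp. $\le 1$), let $D_c(X,G)$ be the set of commuting tuples in $D(X,G)$, and let $\overline D_{cp}(X,G)$ be the set of commuting tuples in $\overline D(X,G)$ that are pure, i.e. $\Phi_T^n(I)\searrow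 0$ (the sequence decreases and tends strongly to $0$). Let $H$ be a complex Hilbert space and let $K$ be a completely positive kernel on $D_c(X,H)$ whose values are normal bounded maps of $B(H)$: for all $V_1,\dots,V_n\in D_c(X,H)$ the map $(a_{ij})\mapsto(K(V_i,V_j)(a_{ij}))$ of $M_n(B(H))$ is completely positive. Let $E_K$ be its reproducing kernel $W^*$-correspondence over $B(H)$, that is, the self-dual $W^*$-module, consisting of functions from $D_c(X,H)$ to the bounded maps of $B(H)$, that is generated by the functions $k_{(a,w)}(z)(b)=K(z,w)(ba^*)$, with right action $(f\cdot c)(z)(b)=f(z)(b)c$ and with $B(H)$-valued inner product satisfying $\langle k_{(a,z)},f\rangle=f(z)(a)$. Suppose that each coordinate function $S_i(T)=T_i$, $1\le i\le d$, is a multiplier of $E_K$, i.e. $f\in E_K$ implies $M_{S_i}f\in E_K$, where $(M_{S_i}f)(z)(b)=S_i(z)f(z)(b)$. Write $M_S=(M_{S_1},\dots,M_{S_d})$ and let $M_S\otimes_{B(H)}I_H=(M_{S_i}\otimes I_H)_{i=1}^d$ be the induced tuple on the Hilbert space $E_K\otimes_{B(H)}H$. 1. If $\Phi_{M_S\otimes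 I_H}(I)$ converges and $\Phi_{M_S\otimes I_H}(I)\le I$, then $\Phi_{M_S\otimes I_H}^n(I)\searrow0$. 2. Consequently, if $E_K$ is an $(X,H)$-contractive reproducing kernel correspondence, that is, if $\sum_{k\ge1}M_S^{(k)}(X_k\otimes I_{E_K})M_S^{(k)*}$ is $w^*$-convergent in the algebra of adjointable operators on $E_K$ and is $\le I$, then $$M_S\otimes_{B(H)}I_H\in\overline D_{cp}(X,E_K\otimes_{B(H)}H).$$ -/

import Mathlib

open scoped ComplexOrder ENNReal CStarAlgebra

namespace WeightedBLH

universe u v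

noncomputable section

/-! ### Operators, the ultraweak (weak-star) topology, normal maps -/

/-- The algebra `B(H)`. -/
abbrev BH (H : Type u) [NormedAddCommGroup H] [InnerProductSpace ℂ H] : Type u := H →L[ℂ] H

section Ultraweak

variable (H : Type u) [NormedAddCommGroup H] [InnerProductSpace ℂ H]

/-- The ultraweak topology of `B(H)`, that is, its weak-star topology as the dual of the trace
class: the coarsest topology for which all functionals `a ↦ ∑ₙ ⟪uₙ, a vₙ⟫`, with `u` and `v`
square summable sequences in `H`, are continuous. -/
abbrev ultraweak : TopologicalSpace (BH H) :=
  TopologicalSpace.induced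
    (fun (a : BH H) (p : lp (fun _ : ℕ => H) 2 × lp (fun _ : ℕ => H) 2) =>
      ∑' n, inner ℂ (p.1 n) (a (p.2 n)))
    Pi.topologicalSpace

variable {H}

/-- The series `∑_{k ≥ 0} f k` of operators converges in the weak-star topology to `P`. -/
def WStarSum (f : ℕ → BH H) (P : BH H) : Prop :=
  Filter.Tendsto (fun N => ∑ k ∈ Finset.range N, f k) Filter.atTop (@nhds _ (ultraweak H) P)

/-- A bounded map of `B(H)` is normal if it is weak-star continuous. -/
def IsNormalMap (φ : BH H →L[ℂ] BH H) : Prop :=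
  @Continuous _ _ (ultraweak H) (ultraweak H) φ

end Ultraweak

/-! ### Admissible sequences, the maps `Φ_T`, and the domains -/

/-- The words of length `k` in the letters `1, …, d`; they index the standard orthonormal basis of
`(ℂ^d)^{⊗ k}`. -/
abbrev Word (d k : ℕ) : Type := Fin k → Fin d

/-- A sequence `X₁, X₂, …` with `X_k` an operator on `(ℂ^d)^{⊗ k}`, given by its matrix with
respect to the standard basis. The term with index `0` plays no role. -/
abbrev WeightSeq (d : ℕ) : Type := (k : ℕ) → Matrix (Word d k) (Word d k) ℂ

/-- Admissibility: `X₁` is invertible, `X_k ≥ 0` for `k ≥ 1`, and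
`limsup ‖X_k‖^{1/k} < ∞` (operator norm on the Hilbert space `(ℂ^d)^{⊗ k}`). -/
structure Admissible {d : ℕ} (X : WeightSeq d) : Prop where
  isUnit_one : IsUnit (X 1)
  posSemidef : ∀ k, 1 ≤ k → (X k).PosSemidef
  limsup_lt : Filter.limsup
    (fun k : ℕ => (‖Matrix.toEuclideanCLM (n := Word d k) (𝕜 := ℂ) (X k)‖ₑ : ℝ≥0∞) ^ ((k : ℝ)⁻¹))
    Filter.atTop < ⊤

/-- `T_α = T_{α(1)} T_{α(2)} ⋯ T_{α(k)}`. -/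
def wordProd {R : Type v} [Monoid R] {d k : ℕ} (T : Fin d → R) (α : Word d k) : R :=
  (List.ofFn fun j => T (α j)).prod

/-- `T_{α(k)} ⋯ T_{α(2)} T_{α(1)}`. -/
def revWordProd {R : Type v} [Monoid R] {d k : ℕ} (T : Fin d → R) (α : Word d k) : R :=
  (List.ofFn fun j => T (α j)).reverse.prod

section Domains

variable {d : ℕ} (X : WeightSeq d)
variable {H : Type u} [NormedAddCommGroup H] [InnerProductSpace ℂ H] [CompleteSpace H]

/-- The operator `T^{(k)} (X_k ⊗ a) T^{(k)*} = ∑_{|α| = |β| = k} x_{α,β} T_α a T_β^*`. -/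
def phiTerm (T : Fin d → BH H) (a : BH H) (k : ℕ) : BH H :=
  ∑ α : Word d k, ∑ β : Word d k, X k α β • (wordProd T α * a * star (wordProd T β))

/-- `∑_{k ≥ 1} T^{(k)} (X_k ⊗ a) T^{(k)*}` converges to `P` in the weak-star topology. -/
def PhiSum (T : Fin d → BH H) (a P : BH H) : Prop :=
  WStarSum (fun k => phiTerm X T a (k + 1)) P

open Classical in
/-- `Φ_T(a) = ∑_{k ≥ 1} T^{(k)} (X_k ⊗ a) T^{(k)*}`, a weak-star limit (`0` if the series does not
converge). -/
def Phi (T : Fin d → BH H) (a : BH H) : BH H :=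
  if h : ∃ P, PhiSum X T a P then h.choose else 0

variable (H) in
/-- `D(X, H)`: the tuples for which the series for `Φ_T(I)` converges and `‖Φ_T(I)‖ < 1`. -/
def D : Set (Fin d → BH H) :=
  {T | (∃ P, PhiSum X T 1 P) ∧ ‖Phi X T 1‖ < 1}

variable (H) in
/-- `D_c(X, H)`: the commuting tuples in `D(X, H)`. -/
def Dc : Set (Fin d → BH H) :=
  {T | T ∈ D X H ∧ ∀ i j, T i * T j = T j * T i}

variable (H) in
/-- The closed version of `D(X, H)`: the series for `Φ_T(I)` converges and `‖Φ_T(I)‖ ≤ 1`. -/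
def DBar : Set (Fin d → BH H) :=
  {T | (∃ P, PhiSum X T 1 P) ∧ ‖Phi X T 1‖ ≤ 1}

/-- `T` is pure: `Φ_T` is defined on all of `B(H)`, and the sequence `Φ_T^n(I)` decreases and
tends to `0` strongly. -/
def IsPure (T : Fin d → BH H) : Prop :=
  (∀ a, ∃ P, PhiSum X T a P) ∧
  Antitone (fun n : ℕ => (Phi X T)^[n] 1) ∧
  ∀ h : H, Filter.Tendsto (fun n : ℕ => ((Phi X T)^[n] 1) h) Filter.atTop (nhds 0)

variable (H) in
/-- The commuting pure tuples in the closed domain. -/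
def DcpBar : Set (Fin d → BH H) :=
  {T | T ∈ DBar X H ∧ (∀ i j, T i * T j = T j * T i) ∧ IsPure X T}

end Domains

/-! ### Completely positive map-valued kernels -/

/-- A completely positive kernel on `S` whose values are normal bounded maps of `B(H)`:
for all points `V₁, …, Vₙ` the map `(a_{ij}) ↦ (K(V_i, V_j)(a_{ij}))` of `Mₙ(B(H))` is completely
positive. -/
structure CPKernel (S : Type v) (H : Type u) [NormedAddCommGroup H] [InnerProductSpace ℂ H]
    [CompleteSpace H] where
  /-- the map `K(z, w)` -/
  toFun : S → S → (BH H →L[ℂ] BH H)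
  normal : ∀ z w, IsNormalMap (toFun z w)
  cp : ∀ (n : ℕ) (V : Fin n → S),
    ∃ Ψ : CStarMatrix (Fin n) (Fin n) (BH H) →CP CStarMatrix (Fin n) (Fin n) (BH H),
      ∀ (A : CStarMatrix (Fin n) (Fin n) (BH H)) (i j : Fin n),
        Ψ A i j = toFun (V i) (V j) (A i j)

section Correspondence

variable {S : Type v} {H : Type u} [NormedAddCommGroup H] [InnerProductSpace ℂ H] [CompleteSpace H]
variable (K : CPKernel S H)

/-- The `B(H)`-valued kernel `⟨k_{(b,z)}, k_{(a,w)}⟩ = K(z, w)(b a^*)` on `S × B(H)`. -/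
def opKernel : Matrix (S × BH H) (S × BH H) (BH H) :=
  Matrix.of fun p q => K.toFun p.1 q.1 (p.2 * star q.2)

lemma exists_eq_star_mul_self {A : Type v} [NonUnitalCStarAlgebra A] [PartialOrder A]
    [StarOrderedRing A] {a : A} (ha : 0 ≤ a) : ∃ b, a = star b * b :=
  CStarAlgebra.nonneg_iff_eq_star_mul_self.mp ha

/-- Complete positivity of `K` makes the matrices `(⟨k_{(b_i,z_i)}, k_{(b_j,z_j)}⟩)` nonnegative. -/
lemma exists_factor (n : ℕ) (p : Fin n → S × BH H) :
    ∃ N : Fin n → Fin n → BH H, ∀ i j,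
      opKernel K (p i) (p j) = ∑ r, star (N r i) * N r j := by
  rcases n with _ | n
  · exact ⟨fun i => i.elim0, fun i => i.elim0⟩
  obtain ⟨Ψ, hΨ⟩ := K.cp (n + 1) fun i => (p i).1
  let C : CStarMatrix (Fin (n + 1)) (Fin (n + 1)) (BH H) :=
    CStarMatrix.ofMatrix (Matrix.of fun r j => if r = 0 then star (p j).2 else 0)
  have hpos : 0 ≤ Ψ (star C * C) := by
    have h0 : (0 : CStarMatrix (Fin (n + 1)) (Fin (n + 1)) (BH H)) ≤ star C * C :=
      star_mul_self_nonneg C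
    exact map_nonneg Ψ h0
  obtain ⟨N, hN⟩ := exists_eq_star_mul_self hpos
  refine ⟨fun r j => N r j, fun i j => ?_⟩
  have h1 := hΨ (star C * C) i j
  rw [hN] at h1
  have h2 : (star C * C) i j = (p i).2 * star (p j).2 := by
    simp [CStarMatrix.mul_apply, CStarMatrix.star_apply, C]
  have h3 : (star N * N) i j = ∑ r, star (N r i) * N r j := by
    simp [CStarMatrix.mul_apply, CStarMatrix.star_apply]
  rw [← h3, h1, h2]
  rfl

lemma opKernel_posSemidef : (opKernel K).PosSemidef := by
  refine ⟨?_, fun x => ?_⟩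
  · ext1 p q
    obtain ⟨N, hN⟩ := exists_factor K 2 ![p, q]
    have h1 := hN 0 1
    have h2 := hN 1 0
    simp only [Matrix.cons_val_zero, Matrix.cons_val_one] at h1 h2
    rw [Matrix.conjTranspose_apply, h1, h2]
    simp
  · set e := x.support.equivFin
    obtain ⟨N, hN⟩ := exists_factor K x.support.card fun i => (e.symm i : S × BH H)
    have key : (x.sum fun i xi => x.sum fun j xj => star xi * opKernel K i j * xj) =
        ∑ r, star (∑ i, N r i * x (e.symm i)) * ∑ i, N r i * x (e.symm i) := by
      have hsum : ∀ f : S × BH H → BH H,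
          ∑ i ∈ x.support, f i = ∑ i, f (e.symm i) := fun f => by
        rw [← Finset.sum_coe_sort]
        exact (Equiv.sum_comp e.symm fun i : x.support => f i).symm
      simp only [Finsupp.sum, hsum, hN, star_sum, Finset.sum_mul, Finset.mul_sum, star_mul]
      rw [Finset.sum_comm' (t' := Finset.univ) (s' := fun _ => Finset.univ) (by simp)]
      conv_rhs => rw [Finset.sum_comm]
      refine Finset.sum_congr rfl fun i _ => ?_
      rw [Finset.sum_comm]
      refine Finset.sum_congr rfl fun r _ => Finset.sum_congr rfl fun j _ => ?_
      simp only [mul_assoc]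
    rw [key]
    exact Finset.sum_nonneg fun r _ => star_mul_self_nonneg _

instance : Fact (opKernel K).PosSemidef := ⟨opKernel_posSemidef K⟩

/-- The interior tensor product `E_K ⊗_{B(H)} H`, constructed before `E_K` itself: it is the Hilbert
space generated by vectors `k_{(a,w)} ⊗ h` with
`⟪k_{(b,z)} ⊗ h, k_{(a,w)} ⊗ g⟫ = ⟪h, K(z, w)(b a^*) g⟫`, realized as a reproducing kernel Hilbert
space of `H`-valued functions on `S × B(H)`. The lemmas `inner_tmul` and `span_tmul_dense` below
show that it is the interior tensor product. -/
def TensorSpace : Type (max u v) := RKHS.OfKernel (opKernel K)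

instance : NormedAddCommGroup (TensorSpace K) :=
  inferInstanceAs (NormedAddCommGroup (RKHS.OfKernel (opKernel K)))

instance : InnerProductSpace ℂ (TensorSpace K) :=
  inferInstanceAs (InnerProductSpace ℂ (RKHS.OfKernel (opKernel K)))

instance : CompleteSpace (TensorSpace K) :=
  inferInstanceAs (CompleteSpace (RKHS.OfKernel (opKernel K)))

instance : RKHS ℂ (TensorSpace K) (S × BH H) H :=
  inferInstanceAs (RKHS ℂ (RKHS.OfKernel (opKernel K)) (S × BH H) H)

/-- The reproducing kernel `W^*`-correspondence `E_K` (as a right `W^*`-module over `B(H)`, with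
right action `f · c = f ∘ c` and with its operator norm). The self-dual completion of a right
Hilbert module `E₀` over `B(H)` is the space of all bounded operators from `H` to
`E₀ ⊗_{B(H)} H`; an element `f` is identified with the function `RKCorr.eval f` from `S` to the
maps of `B(H)`. The lemmas below show that `E_K` is a self-dual module of functions with the
reproducing property for the kernel functions `k_{(a,z)}`, and that these generate it. -/
abbrev RKCorr : Type (max u v) := H →L[ℂ] TensorSpace K

namespace RKCorr

variable {K}

/-- The `B(H)`-valued inner product `⟨f, g⟩ = f^* g`, linear in the second variable. -/
def inner (f g : RKCorr K) : BH H := (ContinuousLinearMap.adjoint f).comp g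

/-- The value `f(z)(b)` of an element of `E_K` as a function. -/
def eval (f : RKCorr K) (z : S) (b : BH H) : BH H :=
  ((RKHS.coeCLM ℂ).comp f |> fun F : H →L[ℂ] (S × BH H → H) =>
    (ContinuousLinearMap.proj (z, b)).comp F)

lemma eval_apply (f : RKCorr K) (z : S) (b : BH H) (h : H) : eval f z b h = (f h) (z, b) := rfl

variable (K) in
/-- The kernel function `k_{(a,w)}`. -/
def ker (a : BH H) (w : S) : RKCorr K := RKHS.kerFun (TensorSpace K) (w, a)

lemma eval_injective {f g : RKCorr K} (h : ∀ z b, eval f z b = eval g z b) : f = g := by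
  ext1 x
  refine RKHS.ext fun p => ?_
  simpa [eval_apply] using congrArg (fun A : BH H => A x) (h p.1 p.2)

/-- The reproducing property `⟨k_{(a,z)}, f⟩ = f(z)(a)`. -/
lemma inner_ker (a : BH H) (z : S) (f : RKCorr K) : inner (ker K a z) f = eval f z a := by
  ext h
  simp [inner, ker, eval_apply]

/-- `k_{(a,w)}(z)(b) = K(z, w)(b a^*)`. -/
lemma eval_ker (a b : BH H) (z w : S) : eval (ker K a w) z b = K.toFun z w (b * star a) := by
  ext h
  have : RKHS.kernel (TensorSpace K) = opKernel K := RKHS.OfKernel.kernel_ofKernel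
  simp [ker, eval_apply, RKHS.kerFun_apply, this, opKernel]

/-- `⟨k_{(b,z)} · c, k_{(a,w)} · d⟩ = c^* K(z, w)(b a^*) d`. -/
lemma inner_ker_ker (a b c d : BH H) (z w : S) :
    inner ((ker K b z).comp c) ((ker K a w).comp d) =
      star c * K.toFun z w (b * star a) * d := by
  rw [← eval_ker a b z w, ← inner_ker]
  simp [inner, ContinuousLinearMap.adjoint_comp, ContinuousLinearMap.star_eq_adjoint,
    ContinuousLinearMap.mul_def, ContinuousLinearMap.comp_assoc]

/-- Self-duality: every bounded module map from `E_K` to `B(H)` is given by an element of `E_K`. -/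
lemma self_dual (τ : RKCorr K →L[ℂ] BH H) (hτ : ∀ f (c : BH H), τ (f.comp c) = τ f * c) :
    ∃ g : RKCorr K, ∀ f, τ f = inner g f := by
  rcases subsingleton_or_nontrivial H with hH | hH
  · exact ⟨0, fun f => ContinuousLinearMap.ext fun x => Subsingleton.elim _ _⟩
  obtain ⟨e, he⟩ := exists_norm_eq H (zero_le_one (α := ℝ))
  let L : TensorSpace K →L[ℂ] H :=
    (ContinuousLinearMap.apply ℂ H e).comp
      (τ.comp (ContinuousLinearMap.smulRightL ℂ H (TensorSpace K) (innerSL ℂ e)))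
  have hL : ∀ x, L x = τ ((innerSL ℂ e).smulRight x) e := fun x => rfl
  refine ⟨ContinuousLinearMap.adjoint L, fun f => ?_⟩
  ext h
  have h1 := hτ f ((innerSL ℂ e).smulRight h)
  have h2 : f.comp ((innerSL ℂ e).smulRight h) = (innerSL ℂ e).smulRight (f h) := by
    ext x
    simp
  rw [h2] at h1
  simp [inner, hL, h1, he]

/-- The elementary tensor `f ⊗ h` in `E_K ⊗_{B(H)} H`. -/
def tmul (f : RKCorr K) (h : H) : TensorSpace K := f h

lemma inner_tmul (f g : RKCorr K) (h k : H) :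
    Inner.inner ℂ (tmul f h) (tmul g k) = Inner.inner ℂ h (inner f g k) := by
  simp [tmul, inner, ContinuousLinearMap.adjoint_inner_right]

lemma span_tmul_dense :
    (Submodule.span ℂ {x : TensorSpace K | ∃ a w h, x = tmul (ker K a w) h}).topologicalClosure
      = ⊤ := by
  rw [← RKHS.kerFun_dense (TensorSpace K)]
  congr 2
  ext x
  constructor
  · rintro ⟨a, w, h, rfl⟩
    exact ⟨(w, a), h, rfl⟩
  · rintro ⟨⟨w, a⟩, h, rfl⟩
    exact ⟨a, w, h, rfl⟩

end RKCorr

/-! ### Multipliers -/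

/-- `φ : S → B(H)` is a multiplier of `E_K` if for every `f ∈ E_K` the function
`(φ f)(z)(b) = φ(z) f(z)(b)` is in `E_K`. -/
def IsMultiplier (φ : S → BH H) : Prop :=
  ∀ f : RKCorr K, ∃ g : RKCorr K, ∀ z b, g.eval z b = φ z * f.eval z b

variable {K} {φ : S → BH H}

lemma IsMultiplier.exists_tensor (hφ : IsMultiplier K φ) :
    ∃ B : TensorSpace K →L[ℂ] TensorSpace K, ∀ x p, (B x) p = φ p.1 (x p) := by
  rcases subsingleton_or_nontrivial H with hH | hH
  · exact ⟨0, fun x p => Subsingleton.elim _ _⟩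
  obtain ⟨e, he⟩ := exists_norm_eq H (zero_le_one (α := ℝ))
  have hex : ∀ x : TensorSpace K, ∃ y : TensorSpace K, ∀ p, y p = φ p.1 (x p) := fun x => by
    obtain ⟨g, hg⟩ := hφ ((innerSL ℂ e).smulRight x)
    refine ⟨g e, fun p => ?_⟩
    have := congrArg (fun A : BH H => A e) (hg p.1 p.2)
    simpa [RKCorr.eval_apply, he] using this
  choose B hB using hex
  let B' : TensorSpace K →ₗ[ℂ] TensorSpace K :=
    { toFun := B
      map_add' := fun x y => RKHS.ext fun p => by simp [hB]
      map_smul' := fun c x => RKHS.ext fun p => by simp [hB] }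
  have hcont : Continuous B' := by
    refine B'.continuous_of_seq_closed_graph fun u x y hu hy => RKHS.ext fun p => ?_
    have h1 : Filter.Tendsto (fun n => (B' (u n)) p) Filter.atTop (nhds (y p)) :=
      ((RKHS.continuous_eval p).tendsto y).comp hy
    have h2 : Filter.Tendsto (fun n => φ p.1 ((u n) p)) Filter.atTop (nhds (φ p.1 (x p))) :=
      ((φ p.1).continuous.tendsto _).comp (((RKHS.continuous_eval p).tendsto x).comp hu)
    have h3 : (fun n => (B' (u n)) p) = fun n => φ p.1 ((u n) p) := funext fun n => hB (u n) p
    rw [h3] at h1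
    exact (tendsto_nhds_unique h1 h2).trans (hB x p).symm
  exact ⟨⟨B', hcont⟩, hB⟩

lemma IsMultiplier.exists_mul (hφ : IsMultiplier K φ) :
    ∃ A : RKCorr K →L[ℂ] RKCorr K, ∀ f z b, (A f).eval z b = φ z * f.eval z b := by
  obtain ⟨B, hB⟩ := hφ.exists_tensor
  refine ⟨ContinuousLinearMap.compL ℂ H (TensorSpace K) (TensorSpace K) B, fun f z b => ?_⟩
  ext h
  simp [RKCorr.eval_apply, hB]

/-- The multiplication operator `M_φ f = φ f` on `E_K`. -/
def IsMultiplier.mul (hφ : IsMultiplier K φ) : RKCorr K →L[ℂ] RKCorr K := hφ.exists_mul.choose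

lemma IsMultiplier.eval_mul (hφ : IsMultiplier K φ) (f : RKCorr K) (z : S) (b : BH H) :
    (hφ.mul f).eval z b = φ z * f.eval z b := hφ.exists_mul.choose_spec f z b

lemma IsMultiplier.exists_mulTensor (hφ : IsMultiplier K φ) :
    ∃ B : TensorSpace K →L[ℂ] TensorSpace K, ∀ f h,
      B (RKCorr.tmul f h) = RKCorr.tmul (hφ.mul f) h := by
  obtain ⟨B, hB⟩ := hφ.exists_tensor
  refine ⟨B, fun f h => RKHS.ext fun p => ?_⟩
  have := congrArg (fun A : BH H => A h) (hφ.eval_mul f p.1 p.2)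
  simpa [RKCorr.eval_apply, RKCorr.tmul, hB] using this.symm

/-- The operator `M_φ ⊗ I_H` on `E_K ⊗_{B(H)} H`, determined by
`(M_φ ⊗ I_H)(f ⊗ h) = (M_φ f) ⊗ h`. -/
def IsMultiplier.mulTensor (hφ : IsMultiplier K φ) : TensorSpace K →L[ℂ] TensorSpace K :=
  hφ.exists_mulTensor.choose

lemma IsMultiplier.mulTensor_tmul (hφ : IsMultiplier K φ) (f : RKCorr K) (h : H) :
    hφ.mulTensor (RKCorr.tmul f h) = RKCorr.tmul (hφ.mul f) h :=
  hφ.exists_mulTensor.choose_spec f h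

lemma IsMultiplier.exists_adj (hφ : IsMultiplier K φ) :
    ∃ N : RKCorr K →L[ℂ] RKCorr K, ∀ f g, (hφ.mul f).inner g = f.inner (N g) := by
  refine ⟨ContinuousLinearMap.compL ℂ H (TensorSpace K) (TensorSpace K)
    (ContinuousLinearMap.adjoint hφ.mulTensor), fun f g => ?_⟩
  have : hφ.mul f = hφ.mulTensor.comp f := by
    ext1 h
    exact (hφ.mulTensor_tmul f h).symm
  simp [RKCorr.inner, this, ContinuousLinearMap.adjoint_comp, ContinuousLinearMap.comp_assoc]

/-- The adjoint `M_φ^*` of the multiplication operator on `E_K`, determined by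
`⟨M_φ f, g⟩ = ⟨f, M_φ^* g⟩`. -/
def IsMultiplier.adj (hφ : IsMultiplier K φ) : RKCorr K →L[ℂ] RKCorr K := hφ.exists_adj.choose

lemma IsMultiplier.inner_adj (hφ : IsMultiplier K φ) (f g : RKCorr K) :
    (hφ.mul f).inner g = f.inner (hφ.adj g) := hφ.exists_adj.choose_spec f g

end Correspondence

/-! ### Contractive reproducing kernel correspondences -/

section Contractive

variable {d : ℕ} (X : WeightSeq d)
variable {H : Type u} [NormedAddCommGroup H] [InnerProductSpace ℂ H] [CompleteSpace H]

variable (H) in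
/-- The coordinate function `S_i(T) = T_i` on `D_c(X, H)`. -/
def coord (i : Fin d) : Dc X H → BH H := fun T => T.1 i

variable {X} {K : CPKernel (Dc X H) H} (hS : ∀ i, IsMultiplier K (coord X H i))

/-- The operator `M_S^{(k)} (X_k ⊗ I) M_S^{(k)*} = ∑_{|α| = |β| = k} x_{α,β} M_{S_α} M_{S_β}^*`
on `E_K`. -/
def coordTerm (k : ℕ) : RKCorr K →L[ℂ] RKCorr K :=
  ∑ α : Word d k, ∑ β : Word d k,
    X k α β • (wordProd (fun i => (hS i).mul) α * revWordProd (fun i => (hS i).adj) β)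

/-- `E_K` is an `(X, H)`-contractive reproducing kernel correspondence:
`∑_{k ≥ 1} M_S^{(k)} (X_k ⊗ I) M_S^{(k)*}` converges in the weak-star topology of the algebra of
adjointable operators on `E_K`, to an operator `Q ≤ I`. -/
def IsXContractive : Prop :=
  ∃ Q : RKCorr K →L[ℂ] RKCorr K,
    (∀ f g : RKCorr K, WStarSum (fun k => f.inner (coordTerm hS (k + 1) g)) (f.inner (Q g))) ∧
    ∀ f : RKCorr K, f.inner (Q f) ≤ f.inner f

/-- The tuple `M_S ⊗ I_H = (M_{S_1} ⊗ I_H, …, M_{S_d} ⊗ I_H)` on `E_K ⊗_{B(H)} H`. -/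
def coordTuple : Fin d → BH (TensorSpace K) := fun i => (hS i).mulTensor

end Contractive

end

end WeightedBLH

namespace WeightedBLH

universe u v

section Operators

variable {H : Type u} [NormedAddCommGroup H] [InnerProductSpace ℂ H]

/-! ### The order of operators and weak-star convergence -/

/-! Write `G = E_K ⊗ H`, `Φ = Φ_{M_S ⊗ I}` and, for `p = (z, b)` with `z ∈ D_c`, let `k_p : H → G`
be the kernel function. Its adjoint is evaluation at `p`, and `M_S ⊗ I` multiplies pointwise by `z`.
Hence adjoints of words act on kernel vectors as on eigenvectors, `M_α^* k_p v = k_p (z_α^* v)`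
(`star_wordProd_coordTuple_kerFun`), and summing gives the intertwining relation `k_p^* Φ(a) k_p =
Φ_z(k_p^* a k_p)` (`compress_phi`).

Iterating it, `k_p^* Φ^n(I) k_p = Φ_z^n(k_p^* k_p) ≤ ‖k_p^* k_p‖ ‖Φ_z(I)‖^n I`, which tends to `0`
because points of the domain satisfy the strict inequality `‖Φ_z(I)‖ < 1`. Since `Φ` is positive and
`Φ(I) ≤ I`, the `Φ^n(I)` are decreasing positive contractions. For these, `‖b v‖² ≤ ⟪v, b v⟫`, so
decay of the quadratic forms on kernel vectors gives strong convergence on their dense span, then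
everywhere (`tendsto_apply_zero_of_dense_span`).

For the second part, every `x ∈ G` is an elementary tensor `(e^* ⊗ x) ⊗ e` with `e` a unit vector of
`H` (when `H ≠ 0`), so weak convergence and the bound pass from `E_K` to `G`; positivity of the
terms upgrades weak to weak-star convergence. -/

lemma le_iff_inner_le {a b : BH H} :
    a ≤ b ↔ ∀ v, inner ℂ v (a v) ≤ inner ℂ v (b v) := by
  rw [ContinuousLinearMap.le_def]
  constructor
  · intro h v
    simpa [inner_sub_right] using h.inner_nonneg_right v
  · intro h
    -- An inequality in `ℂ` also equates imaginary parts; this is what supplies self-adjointness of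
    -- `b - a`.
    rw [ContinuousLinearMap.isPositive_iff_complex]
    intro v
    have h1 : 0 ≤ inner ℂ v ((b - a) v) := by
      simpa [inner_sub_right] using h v
    have h2 : 0 ≤ inner ℂ ((b - a) v) v := by
      rw [← inner_conj_symm, ← RCLike.star_def]
      exact star_nonneg_iff.2 h1
    rw [RCLike.nonneg_iff] at h2
    refine ⟨?_, h2.1⟩
    exact RCLike.ext (by simp) (by simpa [inner_sub_left] using h2.2.symm)

/-- Square summable sequences supported at index `0` turn the defining functionals into matrix
coefficients. -/
lemma WStarSum.tendsto_inner {f : ℕ → BH H} {P : BH H} (h : WStarSum f P) (u v : H) :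
    Filter.Tendsto (fun N => inner ℂ u ((∑ k ∈ Finset.range N, f k) v)) Filter.atTop
      (nhds (inner ℂ u (P v))) := by
  classical
  rw [WStarSum, nhds_induced, Filter.tendsto_comap_iff, tendsto_pi_nhds] at h
  have key : ∀ a : BH H, ∑' n, inner ℂ (lp.single (E := fun _ : ℕ => H) 2 0 u n)
      (a (lp.single (E := fun _ : ℕ => H) 2 0 v n)) = inner ℂ u (a v) := by
    intro a
    rw [tsum_eq_single 0]
    · simp
    · intro n hn
      simp [hn]
  simpa only [Function.comp_def, key] using
    h (lp.single (E := fun _ : ℕ => H) 2 0 u, lp.single (E := fun _ : ℕ => H) 2 0 v)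

lemma WStarSum.unique {f : ℕ → BH H} {P Q : BH H} (hP : WStarSum f P) (hQ : WStarSum f Q) :
    P = Q :=
  ContinuousLinearMap.ext fun v => ext_inner_left ℂ fun u =>
    tendsto_nhds_unique (hP.tendsto_inner u v) (hQ.tendsto_inner u v)

/-- A bounded strongly convergent series converges in the weak-star topology. -/
lemma WStarSum.of_strong {f : ℕ → BH H} {P : BH H} {C : ℝ}
    (hC : ∀ N, ‖∑ k ∈ Finset.range N, f k‖ ≤ C)
    (h : ∀ v, Filter.Tendsto (fun N => (∑ k ∈ Finset.range N, f k) v) Filter.atTop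
      (nhds (P v))) : WStarSum f P := by
  rw [WStarSum, nhds_induced, Filter.tendsto_comap_iff, tendsto_pi_nhds]
  rintro ⟨x, y⟩
  have hs : Summable fun n => C * (‖x n‖ * ‖y n‖) :=
    (lp.summable_mul (p := 2) (q := 2) (by norm_num; exact Real.HolderConjugate.two_two) x y).mul_left C
  refine tendsto_tsum_of_dominated_convergence hs (fun n => ?_) (.of_forall fun N n => ?_)
  · exact (Filter.Tendsto.inner tendsto_const_nhds (h (y n)))
  · calc ‖inner ℂ (x n) ((∑ k ∈ Finset.range N, f k) (y n))‖
        ≤ ‖x n‖ * (‖∑ k ∈ Finset.range N, f k‖ * ‖y n‖) :=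
          (norm_inner_le_norm _ _).trans (by gcongr; exact ContinuousLinearMap.le_opNorm _ _)
      _ ≤ ‖x n‖ * (C * ‖y n‖) := by gcongr; exact hC N
      _ = C * (‖x n‖ * ‖y n‖) := by ring

/-- Needed because `∑'` is additive only on summable families. -/
lemma summable_inner_apply (a : BH H) (x y : lp (fun _ : ℕ => H) 2) :
    Summable fun n => inner ℂ (x n) (a (y n)) := by
  have hs : Summable fun n => ‖a‖ * (‖x n‖ * ‖y n‖) :=
    (lp.summable_mul (p := 2) (q := 2)
      (by norm_num; exact Real.HolderConjugate.two_two) x y).mul_left _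
  refine Summable.of_norm_bounded hs fun n => ?_
  calc ‖inner ℂ (x n) (a (y n))‖ ≤ ‖x n‖ * (‖a‖ * ‖y n‖) :=
        (norm_inner_le_norm _ _).trans (by gcongr; exact a.le_opNorm _)
    _ = ‖a‖ * (‖x n‖ * ‖y n‖) := by ring

lemma WStarSum.add {f g : ℕ → BH H} {P Q : BH H} (hf : WStarSum f P) (hg : WStarSum g Q) :
    WStarSum (fun k => f k + g k) (P + Q) := by
  rw [WStarSum, nhds_induced, Filter.tendsto_comap_iff, tendsto_pi_nhds] at *
  intro x
  simpa only [Function.comp_def, Finset.sum_add_distrib, add_apply, inner_add_right,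
    (summable_inner_apply _ x.1 x.2).tsum_add (summable_inner_apply _ x.1 x.2)]
    using (hf x).add (hg x)

lemma WStarSum.smul {f : ℕ → BH H} {P : BH H} (hf : WStarSum f P) (c : ℂ) :
    WStarSum (fun k => c • f k) (c • P) := by
  rw [WStarSum, nhds_induced, Filter.tendsto_comap_iff, tendsto_pi_nhds] at *
  intro x
  simpa only [Function.comp_def, ← Finset.smul_sum, smul_apply, inner_smul_right, tsum_mul_left]
    using (hf x).const_mul c

variable [CompleteSpace H]

/-- With `b = c^* c`, one has `‖b v‖ ≤ ‖c‖ ‖c v‖` and `‖c‖² = ‖b‖`. This converts control of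
quadratic forms into norm control. -/
lemma norm_sq_apply_le {b : BH H} (hb : 0 ≤ b) (v : H) :
    ‖b v‖ ^ 2 ≤ ‖b‖ * (inner ℂ v (b v)).re := by
  obtain ⟨c, rfl⟩ := exists_eq_star_mul_self hb
  have h1 : (inner ℂ v ((star c * c) v)).re = ‖c v‖ ^ 2 := by
    simp only [mul_apply_eq_comp, ContinuousLinearMap.star_eq_adjoint,
      ContinuousLinearMap.adjoint_inner_right]
    exact inner_self_eq_norm_sq (𝕜 := ℂ) _
  rw [h1, CStarRing.norm_star_mul_self]
  have h2 : ‖(star c * c) v‖ ≤ ‖c‖ * ‖c v‖ := by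
    rw [← norm_star c]
    exact (star c).le_opNorm (c v)
  calc _ ≤ (‖c‖ * ‖c v‖) ^ 2 := by gcongr
    _ = _ := by ring

/-- A bounded increasing sequence of positive operators converges strongly. -/
lemma exists_strong_limit {A : ℕ → BH H} {B : BH H} (h0 : ∀ n, 0 ≤ A n) (hA : Monotone A)
    (hB : ∀ n, A n ≤ B) :
    ∃ P : BH H, ∀ v, Filter.Tendsto (fun n => A n v) Filter.atTop (nhds (P v)) := by
  have hlim : ∀ v, ∃ w, Filter.Tendsto (fun n => A n v) Filter.atTop (nhds w) := by
    intro v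
    have hre : ∀ {a b : BH H}, a ≤ b → (inner ℂ v (a v)).re ≤ (inner ℂ v (b v)).re :=
      fun h => (Complex.le_def.1 (le_iff_inner_le.1 h v)).1
    have hmono : Monotone fun n => (inner ℂ v (A n v)).re := fun m n hmn => hre (hA hmn)
    have hconv := tendsto_atTop_ciSup hmono
      ⟨(inner ℂ v (B v)).re, by rintro _ ⟨n, rfl⟩; exact hre (hB n)⟩
    have hcau := hconv.cauchySeq
    refine cauchySeq_tendsto_of_complete (Metric.cauchySeq_iff'.2 fun ε hε => ?_)
    -- `norm_sq_apply_le` costs a factor `‖A n - A N‖ ≤ ‖B‖`; the `+ 1` keeps the quotient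
    -- meaningful when `B = 0`.
    obtain ⟨N, hN⟩ := Metric.cauchySeq_iff'.1 hcau (ε ^ 2 / (‖B‖ + 1)) (by positivity)
    refine ⟨N, fun n hn => ?_⟩
    have h1 : 0 ≤ A n - A N := sub_nonneg.2 (hA hn)
    have h2 : ‖A n - A N‖ ≤ ‖B‖ := CStarAlgebra.norm_le_norm_of_nonneg_of_le h1
      ((sub_le_self _ (h0 N)).trans (hB n))
    have h3 := norm_sq_apply_le h1 v
    have h4 := hN n hn
    have h5 : (inner ℂ v ((A n - A N) v)).re =
        (inner ℂ v (A n v)).re - (inner ℂ v (A N v)).re := by simp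
    rw [Real.dist_eq, ← h5] at h4
    rw [dist_eq_norm, ← sub_apply]
    refine lt_of_pow_lt_pow_left₀ 2 hε.le ?_
    have h6 := le_abs_self (inner ℂ v ((A n - A N) v)).re
    rw [lt_div_iff₀ (by positivity)] at h4
    refine lt_of_le_of_lt ?_ h4
    calc _ ≤ ‖A n - A N‖ * |(inner ℂ v ((A n - A N) v)).re| := h3.trans (by gcongr)
      _ ≤ (‖B‖ + 1) * |(inner ℂ v ((A n - A N) v)).re| := by gcongr; linarith
      _ = _ := mul_comm _ _
  choose w hw using hlim
  -- The pointwise limit is bounded by Banach–Steinhaus.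
  exact ⟨continuousLinearMapOfTendsto A (tendsto_pi_nhds.2 hw), hw⟩

/-- A series of positive operators with bounded partial sums converges in the weak-star topology. -/
lemma WStarSum.exists_of_nonneg {f : ℕ → BH H} {B : BH H} (hf : ∀ k, 0 ≤ f k)
    (hB : ∀ N, ∑ k ∈ Finset.range N, f k ≤ B) : ∃ P, WStarSum f P := by
  have h0 : ∀ N, 0 ≤ ∑ k ∈ Finset.range N, f k := fun N => Finset.sum_nonneg fun k _ => hf k
  obtain ⟨P, hP⟩ := exists_strong_limit h0
    (fun m n hmn => Finset.sum_le_sum_of_subset_of_nonneg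
      (Finset.range_subset_range.2 hmn) fun k _ _ => hf k) hB
  exact ⟨P, WStarSum.of_strong
    (fun N => CStarAlgebra.norm_le_norm_of_nonneg_of_le (h0 N) (hB N)) hP⟩

/-- Partial sums of a series of positive operators that converges weakly are dominated by the
limit. -/
lemma sum_range_le_of_tendsto_inner {f : ℕ → BH H} {P : BH H} (hf : ∀ k, 0 ≤ f k)
    (h : ∀ v, Filter.Tendsto (fun N => inner ℂ v ((∑ k ∈ Finset.range N, f k) v)) Filter.atTop
      (nhds (inner ℂ v (P v)))) (N : ℕ) : ∑ k ∈ Finset.range N, f k ≤ P := by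
  rw [le_iff_inner_le]
  intro v
  have hmono : Monotone fun N => inner ℂ v ((∑ k ∈ Finset.range N, f k) v) :=
    fun m n hmn => le_iff_inner_le.1 (Finset.sum_le_sum_of_subset_of_nonneg
      (Finset.range_subset_range.2 hmn) fun k _ _ => hf k) v
  exact hmono.ge_of_tendsto (h v) N

/-- A series of positive operators that converges weakly converges in the weak-star topology. -/
lemma WStarSum.of_tendsto_inner {f : ℕ → BH H} {P : BH H} (hf : ∀ k, 0 ≤ f k)
    (h : ∀ u v, Filter.Tendsto (fun N => inner ℂ u ((∑ k ∈ Finset.range N, f k) v)) Filter.atTop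
      (nhds (inner ℂ u (P v)))) : WStarSum f P := by
  obtain ⟨Q, hQ⟩ := WStarSum.exists_of_nonneg hf
    (sum_range_le_of_tendsto_inner hf fun v => h v v)
  have : Q = P := ContinuousLinearMap.ext fun v => ext_inner_left ℂ fun u =>
    tendsto_nhds_unique (hQ.tendsto_inner u v) (h u v)
  exact this ▸ hQ

end Operators

section PhiMap

variable {d : ℕ} {X : WeightSeq d}
variable {H : Type u} [NormedAddCommGroup H] [InnerProductSpace ℂ H] [CompleteSpace H]
variable {T : Fin d → BH H}

/-! ### The maps `Φ_T` -/

lemma phiTerm_add (T : Fin d → BH H) (a b : BH H) (k : ℕ) :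
    phiTerm X T (a + b) k = phiTerm X T a k + phiTerm X T b k := by
  simp only [phiTerm, mul_add, add_mul, smul_add, Finset.sum_add_distrib]

lemma phiTerm_smul (T : Fin d → BH H) (c : ℂ) (a : BH H) (k : ℕ) :
    phiTerm X T (c • a) k = c • phiTerm X T a k := by
  simp only [phiTerm, Finset.smul_sum, mul_smul_comm, smul_mul_assoc]
  exact Finset.sum_congr rfl fun α _ => Finset.sum_congr rfl fun β _ => smul_comm _ _ _

open scoped MatrixOrder in
-- Factoring `X_k = Y^* Y` writes the term as `∑_γ W_γ a W_γ^*` with `W_γ = ∑_α conj(Y_{γ,α}) T_α`.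
lemma phiTerm_nonneg {k : ℕ} (hk : (X k).PosSemidef) (T : Fin d → BH H) {a : BH H}
    (ha : 0 ≤ a) : 0 ≤ phiTerm X T a k := by
  obtain ⟨Y, hY⟩ : ∃ Y : Matrix (Word d k) (Word d k) ℂ, X k = star Y * Y :=
    CStarAlgebra.nonneg_iff_eq_star_mul_self.mp hk.nonneg
  have key : phiTerm X T a k = ∑ γ, (∑ α, star (Y γ α) • wordProd T α) * a *
      star (∑ β, star (Y γ β) • wordProd T β) := by
    have h1 : ∀ γ, (∑ α, star (Y γ α) • wordProd T α) * a *
        star (∑ β, star (Y γ β) • wordProd T β) =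
        ∑ α, ∑ β, (star (Y γ α) * Y γ β) • (wordProd T α * a * star (wordProd T β)) := fun γ => by
      simp only [star_sum, star_smul, star_star, Finset.mul_sum, Finset.sum_mul, mul_smul_comm,
        smul_mul_assoc, Finset.smul_sum, smul_smul]
      exact Finset.sum_comm.trans (Finset.sum_congr rfl fun α _ =>
        Finset.sum_congr rfl fun β _ => by rw [mul_comm])
    simp only [h1, phiTerm, hY, Matrix.mul_apply, Matrix.star_apply, Finset.sum_smul]
    exact (Finset.sum_congr rfl fun α _ => Finset.sum_comm).trans Finset.sum_comm
  rw [key]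
  exact Finset.sum_nonneg fun γ _ => star_right_conjugate_nonneg ha _

variable (hX : ∀ k, 1 ≤ k → (X k).PosSemidef)
include hX

/-- Positive operators span `B(H)`, and for `a ≥ 0` the bound `a ≤ ‖a‖ I` dominates the series by
`‖a‖` times the one at `I`. -/
lemma exists_phiSum (h : ∃ P, PhiSum X T 1 P) (a : BH H) : ∃ P, PhiSum X T a P := by
  obtain ⟨P, hP⟩ := h
  have hle := sum_range_le_of_tendsto_inner
    (fun k => phiTerm_nonneg (hX (k + 1) (by lia)) T zero_le_one) fun v => hP.tendsto_inner v v
  have ha : a ∈ Submodule.span ℂ {a : BH H | 0 ≤ a} := by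
    rw [CStarAlgebra.span_nonneg]; trivial
  induction ha using Submodule.span_induction with
  | mem a ha =>
    have ha : 0 ≤ a := ha
    refine WStarSum.exists_of_nonneg (B := (‖a‖ : ℂ) • P)
      (fun k => phiTerm_nonneg (hX (k + 1) (by lia)) T ha) fun N => ?_
    have h1 : 0 ≤ (‖a‖ : ℂ) • (1 : BH H) - a := by
      have := (IsSelfAdjoint.of_nonneg ha).le_algebraMap_norm_self
      rw [sub_nonneg]
      simpa [Algebra.algebraMap_eq_smul_one] using this
    have h2 : ∀ k, phiTerm X T a (k + 1) ≤ (‖a‖ : ℂ) • phiTerm X T 1 (k + 1) := fun k => by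
      have h3 := phiTerm_nonneg (hX (k + 1) (by lia)) T h1
      have h4 := phiTerm_add (X := X) T ((‖a‖ : ℂ) • (1 : BH H) - a) a (k + 1)
      rw [sub_add_cancel, phiTerm_smul] at h4
      rw [h4]
      exact le_add_of_nonneg_left h3
    calc _ ≤ ∑ k ∈ Finset.range N, (‖a‖ : ℂ) • phiTerm X T 1 (k + 1) :=
          Finset.sum_le_sum fun k _ => h2 k
      _ ≤ (‖a‖ : ℂ) • P := by
          rw [← Finset.smul_sum]
          exact smul_le_smul_of_nonneg_left (hle N) (by simp)
  | zero =>
    exact WStarSum.exists_of_nonneg (B := 0)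
      (fun k => phiTerm_nonneg (hX (k + 1) (by lia)) T le_rfl) fun N => by simp [phiTerm]
  | add a b _ _ ha hb =>
    obtain ⟨P, hP⟩ := ha
    obtain ⟨Q, hQ⟩ := hb
    exact ⟨P + Q, by simpa only [PhiSum, phiTerm_add] using WStarSum.add hP hQ⟩
  | smul c a _ ha =>
    obtain ⟨P, hP⟩ := ha
    exact ⟨c • P, by simpa only [PhiSum, phiTerm_smul] using WStarSum.smul hP c⟩

omit hX in
lemma PhiSum.phi_eq {a P : BH H} (h : PhiSum X T a P) : Phi X T a = P := by
  have h' : ∃ P, PhiSum X T a P := ⟨P, h⟩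
  rw [Phi, dif_pos h']
  exact h'.choose_spec.unique h

lemma phiSum_phi (h : ∃ P, PhiSum X T 1 P) (a : BH H) : PhiSum X T a (Phi X T a) := by
  obtain ⟨P, hP⟩ := exists_phiSum hX h a
  rwa [hP.phi_eq]

lemma phi_nonneg (h : ∃ P, PhiSum X T 1 P) {a : BH H} (ha : 0 ≤ a) : 0 ≤ Phi X T a := by
  -- The empty partial sum is `0`, and the limit dominates it.
  simpa using sum_range_le_of_tendsto_inner
    (fun k => phiTerm_nonneg (hX (k + 1) (by lia)) T ha)
    (fun v => (phiSum_phi hX h a).tendsto_inner v v) 0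

lemma phi_add (h : ∃ P, PhiSum X T 1 P) (a b : BH H) :
    Phi X T (a + b) = Phi X T a + Phi X T b := by
  refine PhiSum.phi_eq ?_
  simpa only [PhiSum, phiTerm_add] using
    WStarSum.add (phiSum_phi hX h a) (phiSum_phi hX h b)

lemma phi_smul (h : ∃ P, PhiSum X T 1 P) (c : ℂ) (a : BH H) :
    Phi X T (c • a) = c • Phi X T a := by
  refine PhiSum.phi_eq ?_
  simpa only [PhiSum, phiTerm_smul] using WStarSum.smul (phiSum_phi hX h a) c

lemma phi_mono (h : ∃ P, PhiSum X T 1 P) : Monotone (Phi X T) := by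
  intro a b hab
  have h1 := phi_nonneg hX h (sub_nonneg.2 hab)
  have h2 := phi_add hX h (b - a) a
  rw [sub_add_cancel] at h2
  rw [h2]
  exact le_add_of_nonneg_left h1

lemma phi_iterate_nonneg (h : ∃ P, PhiSum X T 1 P) (n : ℕ) : 0 ≤ (Phi X T)^[n] 1 := by
  induction n with
  | zero => exact zero_le_one
  | succ n ih =>
    rw [Function.iterate_succ_apply']
    exact phi_nonneg hX h ih

lemma antitone_phi_iterate (h : ∃ P, PhiSum X T 1 P) (h1 : Phi X T 1 ≤ 1) :
    Antitone fun n : ℕ => (Phi X T)^[n] 1 :=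
  (phi_mono hX h).antitone_iterate_of_map_le h1

end PhiMap

/-- Positive contractions `b n` such that `⟪v, b n v⟫ → 0` for all `v` in a set with dense linear
span converge strongly to `0`. -/
lemma tendsto_apply_zero_of_dense_span {G : Type u} [NormedAddCommGroup G] [InnerProductSpace ℂ G]
    [CompleteSpace G] {b : ℕ → BH G} (h0 : ∀ n, 0 ≤ b n) (h1 : ∀ n, b n ≤ 1) {s : Set G}
    (hs : (Submodule.span ℂ s).topologicalClosure = ⊤)
    (h : ∀ v ∈ s, Filter.Tendsto (fun n => (inner ℂ v (b n v)).re) Filter.atTop (nhds 0)) (v : G) :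
    Filter.Tendsto (fun n => b n v) Filter.atTop (nhds 0) := by
  have hn : ∀ n, ‖b n‖ ≤ 1 := fun n =>
    (CStarAlgebra.norm_le_norm_of_nonneg_of_le (h0 n) (h1 n)).trans
      ContinuousLinearMap.norm_id_le
  have hspan : ∀ v ∈ Submodule.span ℂ s,
      Filter.Tendsto (fun n => b n v) Filter.atTop (nhds 0) := by
    intro v hv
    induction hv using Submodule.span_induction with
    | mem v hv =>
      rw [tendsto_zero_iff_norm_tendsto_zero]
      have hsq : Filter.Tendsto (fun n => ‖b n v‖ ^ 2) Filter.atTop (nhds 0) :=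
        squeeze_zero (fun n => by positivity) (fun n => (norm_sq_apply_le (h0 n) v).trans
          (mul_le_of_le_one_left ((Complex.le_def.1
            (by simpa using le_iff_inner_le.1 (h0 n) v)).1) (hn n))) (h v hv)
      simpa using hsq.sqrt
    | zero => simp
    | add x y _ _ hx hy => simpa using hx.add hy
    | smul c x _ hx => simpa using hx.const_smul c
  rw [Metric.tendsto_atTop]
  intro ε hε
  have hv : v ∈ closure (Submodule.span ℂ s : Set G) := by
    rw [← Submodule.topologicalClosure_coe, hs]; trivial
  obtain ⟨w, hw, hvw⟩ := Metric.mem_closure_iff.1 hv (ε / 2) (by positivity)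
  obtain ⟨N, hN⟩ := Metric.tendsto_atTop.1 (hspan w hw) (ε / 2) (by positivity)
  refine ⟨N, fun n hnN => ?_⟩
  have h2 := hN n hnN
  rw [dist_zero_right] at h2 ⊢
  rw [dist_eq_norm] at hvw
  calc ‖b n v‖ = ‖b n (v - w) + b n w‖ := by simp
    _ ≤ ‖b n (v - w)‖ + ‖b n w‖ := norm_add_le _ _
    _ ≤ 1 * ‖v - w‖ + ‖b n w‖ := by
        gcongr; exact (b n).le_of_opNorm_le (hn n) _
    _ < ε := by linarith

section Kernel

variable {S : Type v} {H : Type u} [NormedAddCommGroup H] [InnerProductSpace ℂ H] [CompleteSpace H]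
variable {K : CPKernel S H}

/-! ### Multiplication operators on `E_K ⊗ H` -/

/-- Settles the case `H = 0`, where no unit vector is available. -/
lemma subsingleton_tensorSpace [Subsingleton H] : Subsingleton (TensorSpace K) :=
  ⟨fun _ _ => RKHS.ext fun _ => Subsingleton.elim _ _⟩

lemma RKCorr.inner_apply (f g : RKCorr K) (h k : H) :
    Inner.inner ℂ h (f.inner g k) = Inner.inner ℂ (f h) (g k) := by
  simp [RKCorr.inner, ContinuousLinearMap.adjoint_inner_right]

/-- Testing against the rank one elements `e^* ⊗ y` recovers all coefficients `⟪y, g v⟫`. -/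
lemma RKCorr.ext_inner {g g' : RKCorr K} (h : ∀ f : RKCorr K, f.inner g = f.inner g') :
    g = g' := by
  ext1 v
  refine ext_inner_left ℂ fun y => ?_
  rcases subsingleton_or_nontrivial H with hH | hH
  · have := subsingleton_tensorSpace (K := K)
    rw [Subsingleton.elim (g v) (g' v)]
  obtain ⟨e, he⟩ := exists_norm_eq H (zero_le_one (α := ℝ))
  have h1 := congrArg (fun A : BH H => Inner.inner ℂ e (A v)) (h ((innerSL ℂ e).smulRight y))
  simpa [RKCorr.inner_apply, he] using h1

variable {φ : S → BH H}

lemma IsMultiplier.mulTensor_comp (hφ : IsMultiplier K φ) (f : RKCorr K) :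
    hφ.mulTensor.comp f = hφ.mul f :=
  ContinuousLinearMap.ext (hφ.mulTensor_tmul f)

/-- `mulTensor` is known only on elementary tensors, but each `x` is one, namely `(e^* ⊗ x) ⊗ e`. -/
lemma IsMultiplier.mulTensor_apply (hφ : IsMultiplier K φ) (x : TensorSpace K) (p : S × BH H) :
    (hφ.mulTensor x) p = φ p.1 (x p) := by
  rcases subsingleton_or_nontrivial H with hH | hH
  · exact Subsingleton.elim _ _
  obtain ⟨e, he⟩ := exists_norm_eq H (zero_le_one (α := ℝ))
  have h1 := hφ.mulTensor_tmul ((innerSL ℂ e).smulRight x) e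
  have h2 := congrArg (fun A : BH H => A e) (hφ.eval_mul ((innerSL ℂ e).smulRight x) p.1 p.2)
  simp only [RKCorr.eval_apply, mul_apply_eq_comp, RKCorr.tmul] at h1 h2
  rw [← h1] at h2
  simpa [he] using h2

lemma IsMultiplier.adjoint_mulTensor_comp (hφ : IsMultiplier K φ) (g : RKCorr K) :
    (star hφ.mulTensor).comp g = hφ.adj g := by
  refine RKCorr.ext_inner fun f => ?_
  rw [← hφ.inner_adj f g, ← hφ.mulTensor_comp f]
  simp [RKCorr.inner, ContinuousLinearMap.adjoint_comp, ContinuousLinearMap.comp_assoc,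
    ContinuousLinearMap.star_eq_adjoint]

end Kernel

section Coordinates

variable {d : ℕ} {X : WeightSeq d}
variable {H : Type u} [NormedAddCommGroup H] [InnerProductSpace ℂ H] [CompleteSpace H]
variable {K : CPKernel (Dc X H) H} (hS : ∀ i, IsMultiplier K (coord X H i))

/-! ### The coordinate tuple -/

/-- Lists allow induction letter by letter, without the length `k` in the type. -/
lemma wordProd_eq_map_prod {R : Type v} [Monoid R] {k : ℕ} (T : Fin d → R) (α : Word d k) :
    wordProd T α = ((List.ofFn α).map T).prod := by
  rw [wordProd, List.map_ofFn]; rfl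

lemma revWordProd_eq_map_prod {R : Type v} [Monoid R] {k : ℕ} (T : Fin d → R) (α : Word d k) :
    revWordProd T α = ((List.ofFn α).reverse.map T).prod := by
  rw [revWordProd, List.map_reverse, List.map_ofFn]; rfl

lemma star_wordProd {R : Type v} [Monoid R] [StarMul R] {k : ℕ} (T : Fin d → R) (α : Word d k) :
    star (wordProd T α) = revWordProd (fun i => star (T i)) α := by
  rw [wordProd_eq_map_prod, revWordProd_eq_map_prod]
  induction List.ofFn α with
  | nil => simp
  | cons i l ih => simp [ih]

lemma coordTuple_comm (i j : Fin d) :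
    coordTuple hS i * coordTuple hS j = coordTuple hS j * coordTuple hS i := by
  ext1 x
  refine RKHS.ext fun p => ?_
  have h := congrArg (fun A : BH H => A (x p)) (p.1.2.2 i j)
  simpa [coordTuple, IsMultiplier.mulTensor_apply, coord] using h

lemma wordProd_coordTuple_apply {k : ℕ} (α : Word d k) (x : TensorSpace K) (p : Dc X H × BH H) :
    (wordProd (coordTuple hS) α x) p = wordProd p.1.1 α (x p) := by
  simp only [wordProd_eq_map_prod]
  induction List.ofFn α with
  | nil => simp
  | cons i l ih => simp [ih, coordTuple, IsMultiplier.mulTensor_apply, coord]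

/-- The eigenvector relation: pairing with `x` and using the reproducing property reduces it to
`(M_α x)(p) = z_α x(p)`. -/
lemma star_wordProd_coordTuple_kerFun {k : ℕ} (α : Word d k) (p : Dc X H × BH H) (v : H) :
    star (wordProd (coordTuple hS) α) (RKHS.kerFun (TensorSpace K) p v) =
      RKHS.kerFun (TensorSpace K) p (star (wordProd p.1.1 α) v) := by
  refine ext_inner_right ℂ fun x => ?_
  rw [ContinuousLinearMap.star_eq_adjoint, ContinuousLinearMap.star_eq_adjoint,
    ContinuousLinearMap.adjoint_inner_left, RKHS.kerFun_inner, RKHS.kerFun_inner,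
    ContinuousLinearMap.adjoint_inner_left, wordProd_coordTuple_apply]

/-- The compression `k_p^* a k_p` of an operator on `E_K ⊗ H` by a kernel function. -/
noncomputable def compress (p : Dc X H × BH H) (a : BH (TensorSpace K)) : BH H :=
  (ContinuousLinearMap.adjoint (RKHS.kerFun (TensorSpace K) p)).comp
    (a.comp (RKHS.kerFun (TensorSpace K) p))

lemma compress_apply (p : Dc X H × BH H) (a : BH (TensorSpace K)) (v : H) :
    compress p a v = (a (RKHS.kerFun (TensorSpace K) p v)) p := by
  simp [compress, RKHS.adjoint_kerFun]

lemma inner_compress (p : Dc X H × BH H) (a : BH (TensorSpace K)) (u v : H) :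
    inner ℂ u (compress p a v) =
      inner ℂ (RKHS.kerFun (TensorSpace K) p u) (a (RKHS.kerFun (TensorSpace K) p v)) := by
  rw [compress_apply, RKHS.kerFun_inner]

lemma compress_nonneg (p : Dc X H × BH H) {a : BH (TensorSpace K)} (ha : 0 ≤ a) :
    0 ≤ compress p a := by
  rw [le_iff_inner_le] at ha ⊢
  intro v
  simpa [inner_compress] using ha (RKHS.kerFun (TensorSpace K) p v)

lemma compress_sum {ι : Type*} (s : Finset ι) (p : Dc X H × BH H) (f : ι → BH (TensorSpace K)) :
    compress p (∑ i ∈ s, f i) = ∑ i ∈ s, compress p (f i) := by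
  simp only [compress, ContinuousLinearMap.finsetSum_comp, ContinuousLinearMap.comp_finsetSum]

/-- Adjoint words on the right pass through `k_p`; words on the left come out of evaluation at `p`.
-/
lemma compress_phiTerm (p : Dc X H × BH H) (a : BH (TensorSpace K)) (k : ℕ) :
    compress p (phiTerm X (coordTuple hS) a k) = phiTerm X p.1.1 (compress p a) k := by
  ext v
  simp only [compress_apply, phiTerm, sum_apply, smul_apply, mul_apply_eq_comp,
    star_wordProd_coordTuple_kerFun]
  rw [← RKHS.adjoint_kerFun]
  simp [RKHS.adjoint_kerFun, wordProd_coordTuple_apply]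

/-! ### Decay of the iterates along kernel functions, and purity -/

variable (hX : ∀ k, 1 ≤ k → (X k).PosSemidef)
include hX

/-- The kernel functions intertwine `Φ_{M_S ⊗ I}` and `Φ_z`. -/
lemma compress_phi (h : ∃ P, PhiSum X (coordTuple hS) 1 P) (p : Dc X H × BH H)
    (a : BH (TensorSpace K)) :
    compress p (Phi X (coordTuple hS) a) = Phi X p.1.1 (compress p a) := by
  refine ContinuousLinearMap.ext fun v => ext_inner_left ℂ fun u => ?_
  have h1 := (phiSum_phi hX h a).tendsto_inner
    (RKHS.kerFun (TensorSpace K) p u) (RKHS.kerFun (TensorSpace K) p v)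
  -- Membership of `z` in the domain gives convergence of its series at `I`, hence at every
  -- operator.
  have h2 := (phiSum_phi hX p.1.2.1.1 (compress p a)).tendsto_inner u v
  simp only [← inner_compress, compress_sum, compress_phiTerm] at h1
  exact tendsto_nhds_unique h1 h2

lemma compress_phi_iterate_le (h : ∃ P, PhiSum X (coordTuple hS) 1 P) (p : Dc X H × BH H) (n : ℕ) :
    compress p ((Phi X (coordTuple hS))^[n] 1) ≤
      ((‖compress (K := K) p 1‖ * ‖Phi X p.1.1 1‖ ^ n : ℝ) : ℂ) • (1 : BH H) := by
  have hle : ∀ {a : BH H}, 0 ≤ a → a ≤ (‖a‖ : ℂ) • (1 : BH H) := fun {a} ha => by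
    simpa [Algebra.algebraMap_eq_smul_one] using
      (IsSelfAdjoint.of_nonneg ha).le_algebraMap_norm_self
  induction n with
  | zero => simpa using hle (compress_nonneg p zero_le_one)
  | succ n ih =>
    rw [Function.iterate_succ_apply', compress_phi hS hX h]
    -- Each iteration gains one factor from `Φ_z(I) ≤ ‖Φ_z(I)‖ I`.
    refine (phi_mono hX p.1.2.1.1 ih).trans ?_
    rw [phi_smul hX p.1.2.1.1]
    calc _ ≤ ((‖compress (K := K) p 1‖ * ‖Phi X p.1.1 1‖ ^ n : ℝ) : ℂ) •
          ((‖Phi X p.1.1 1‖ : ℂ) • (1 : BH H)) := by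
          refine smul_le_smul_of_nonneg_left (hle (phi_nonneg hX p.1.2.1.1 zero_le_one)) ?_
          exact Complex.zero_le_real.2 (by positivity)
      _ = _ := by rw [smul_smul]; push_cast; ring_nf

lemma tendsto_inner_phi_iterate_kerFun (h : ∃ P, PhiSum X (coordTuple hS) 1 P)
    (p : Dc X H × BH H) (v : H) :
    Filter.Tendsto (fun n => (inner ℂ (RKHS.kerFun (TensorSpace K) p v)
      (((Phi X (coordTuple hS))^[n] 1) (RKHS.kerFun (TensorSpace K) p v))).re)
      Filter.atTop (nhds 0) := by
  have hlim : Filter.Tendsto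
      (fun n => ‖compress (K := K) p 1‖ * ‖Phi X p.1.1 1‖ ^ n * ‖v‖ ^ 2) Filter.atTop (nhds 0) := by
    have h3 := ((tendsto_pow_atTop_nhds_zero_of_lt_one (norm_nonneg _) p.1.2.1.2).const_mul
      ‖compress (K := K) p 1‖).mul_const (‖v‖ ^ 2)
    rwa [mul_zero, zero_mul] at h3
  refine squeeze_zero (fun n => ?_) (fun n => ?_) hlim
  · have h2 := (Complex.le_def.1 (le_iff_inner_le.1
      (compress_nonneg p (phi_iterate_nonneg hX h n)) v)).1
    rwa [inner_compress, zero_apply, inner_zero_right] at h2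
  · have h2 := (Complex.le_def.1 (le_iff_inner_le.1 (compress_phi_iterate_le hS hX h p n) v)).1
    rw [inner_compress] at h2
    refine h2.trans_eq ?_
    rw [smul_apply, inner_smul_right, Complex.re_ofReal_mul, one_apply_eq_self]
    congr 1
    exact inner_self_eq_norm_sq (𝕜 := ℂ) v

/-- The bound `Φ(I) ≤ I` only makes the iterates decrease and stay below `I`; decay on kernel
vectors needs just convergence of the series. -/
lemma isPure_coordTuple (h : ∃ P, PhiSum X (coordTuple hS) 1 P)
    (h1 : Phi X (coordTuple hS) 1 ≤ 1) : IsPure X (coordTuple hS) := by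
  have hanti : Antitone fun n : ℕ => (Phi X (coordTuple hS))^[n] 1 :=
    antitone_phi_iterate hX h h1
  have hle : ∀ n : ℕ, (Phi X (coordTuple hS))^[n] 1 ≤ 1 := fun n => by
    simpa only [Function.iterate_zero, id_eq] using hanti (Nat.zero_le n)
  have hlim : ∀ v ∈ {x | ∃ p w, RKHS.kerFun (TensorSpace K) p w = x}, Filter.Tendsto
      (fun n => (inner ℂ v (((Phi X (coordTuple hS))^[n] 1) v)).re) Filter.atTop (nhds 0) := by
    rintro _ ⟨p, v, rfl⟩
    exact tendsto_inner_phi_iterate_kerFun hS hX h p v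
  exact ⟨exists_phiSum hX h, hanti, tendsto_apply_zero_of_dense_span (phi_iterate_nonneg hX h) hle
    (RKHS.kerFun_dense (TensorSpace K)) hlim⟩

/-! ### Passage from `E_K` to `E_K ⊗ H` -/

omit hX in
-- Both `M_φ` and `M_φ^*` act on `E_K` by left composition with operators on `E_K ⊗ H`, so products
-- of them do too.
lemma coordTerm_apply (k : ℕ) (g : RKCorr K) :
    coordTerm hS k g = (phiTerm X (coordTuple hS) 1 k).comp g := by
  have hm : ∀ (l : List (Fin d)) (g : RKCorr K),
      (l.map fun i => (hS i).mul).prod g = ((l.map (coordTuple hS)).prod).comp g := by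
    intro l g
    induction l with
    | nil => rfl
    | cons i l ih =>
      simp only [List.map_cons, List.prod_cons, mul_apply_eq_comp, ih, ← (hS i).mulTensor_comp]
      rfl
  have ha : ∀ (l : List (Fin d)) (g : RKCorr K),
      (l.map fun i => (hS i).adj).prod g =
        ((l.map fun i => star (coordTuple hS i)).prod).comp g := by
    intro l g
    induction l with
    | nil => rfl
    | cons i l ih =>
      simp only [List.map_cons, List.prod_cons, mul_apply_eq_comp, ih,
        ← (hS i).adjoint_mulTensor_comp]
      rfl
  ext1 v
  simp only [phiTerm, star_wordProd]
  simp only [coordTerm, sum_apply, smul_apply, mul_apply_eq_comp,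
    wordProd_eq_map_prod, revWordProd_eq_map_prod, hm, ha, ContinuousLinearMap.comp_apply, mul_one]

/-- Contractivity of `E_K` gives the convergence of the series for `Φ_{M_S ⊗ I}(I)`, to a
contraction. -/
lemma IsXContractive.exists_phiSum_le_one (h : IsXContractive hS) :
    ∃ P, PhiSum X (coordTuple hS) 1 P ∧ P ≤ 1 := by
  obtain ⟨Q, hQ, hQ1⟩ := h
  rcases subsingleton_or_nontrivial H with hH | hH
  · have := subsingleton_tensorSpace (K := K)
    have h0 : ∀ a b : BH (TensorSpace K), a = b := fun a b =>
      ContinuousLinearMap.ext fun _ => Subsingleton.elim _ _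
    refine ⟨0, WStarSum.of_strong (C := 0) (fun N => ?_) (fun v => ?_), (h0 _ _).le⟩
    · rw [h0 (∑ k ∈ Finset.range N, _) 0, norm_zero]
    · rw [Subsingleton.elim (fun N => _) fun _ => (0 : BH (TensorSpace K)) v]
      exact tendsto_const_nhds
  obtain ⟨e, he⟩ := exists_norm_eq H (zero_le_one (α := ℝ))
  -- `R x = e^* ⊗ x` lifts `x` to `E_K`, and evaluating at `e` recovers `x`; thus `P` is `Q`
  -- transported to the Hilbert space.
  let R : TensorSpace K →L[ℂ] RKCorr K :=
    ContinuousLinearMap.smulRightL ℂ H (TensorSpace K) (innerSL ℂ e)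
  have hR : ∀ x, R x e = x := fun x => by simp [R, he]
  let P : BH (TensorSpace K) := (ContinuousLinearMap.apply ℂ (TensorSpace K) e).comp (Q.comp R)
  have hP : ∀ x, P x = Q (R x) e := fun x => rfl
  refine ⟨P, WStarSum.of_tendsto_inner
    (fun k => phiTerm_nonneg (hX (k + 1) (by lia)) _ zero_le_one) fun x y => ?_, ?_⟩
  · have h1 := (hQ (R x) (R y)).tendsto_inner e e
    have h2 : ∀ N, inner ℂ e ((∑ k ∈ Finset.range N, (R x).inner (coordTerm hS (k + 1) (R y))) e) =
        inner ℂ x ((∑ k ∈ Finset.range N, phiTerm X (coordTuple hS) 1 (k + 1)) y) := fun N => by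
      simp only [sum_apply, inner_sum, RKCorr.inner_apply, coordTerm_apply, hR,
        ContinuousLinearMap.comp_apply]
    simpa only [h2, RKCorr.inner_apply, hR, ← hP] using h1
  · rw [le_iff_inner_le]
    intro x
    simpa only [RKCorr.inner_apply, hR, ← hP, one_apply_eq_self] using le_iff_inner_le.1 (hQ1 (R x)) e

lemma IsXContractive.coordTuple_mem (h : IsXContractive hS) :
    coordTuple hS ∈ DcpBar X (TensorSpace K) := by
  obtain ⟨P, hP, hP1⟩ := h.exists_phiSum_le_one hS hX
  have hex : ∃ P, PhiSum X (coordTuple hS) 1 P := ⟨P, hP⟩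
  rw [← hP.phi_eq] at hP1
  refine ⟨⟨hex, ?_⟩, coordTuple_comm hS, isPure_coordTuple hS hX hex hP1⟩
  exact (CStarAlgebra.norm_le_norm_of_nonneg_of_le (phi_nonneg hX hex zero_le_one) hP1).trans
    ContinuousLinearMap.norm_id_le

end Coordinates

end WeightedBLH

open WeightedBLH in
theorem proposition5p3
    {d : ℕ} (hd : 0 < d) (X : WeightSeq d) (hX : Admissible X)
    {H : Type*} [NormedAddCommGroup H] [InnerProductSpace ℂ H] [CompleteSpace H]
    (K : CPKernel (Dc X H) H)
    (hS : ∀ i, IsMultiplier K (coord X H i)) :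
    ((∃ P, PhiSum X (coordTuple hS) 1 P) ∧ Phi X (coordTuple hS) 1 ≤ 1 →
      IsPure X (coordTuple hS)) ∧
    (IsXContractive hS → coordTuple hS ∈ DcpBar X (TensorSpace K)) := by
  have hX' := hX.posSemidef
  exact ⟨fun h => isPure_coordTuple hS hX' h.1 h.2, fun h => h.coordTuple_mem hS hX'⟩
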